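/- Let $n\ge 1$ and let $a_1,\dots,a_n\ge 1$, $b_1,\dots,b_n\ge 0$ be integers. Number the coordinates of $\mathbb C^n$ modulo $n$, so that $z_{n+1}=z_1$, and put $$f_{II}(\mathbf z,\bar{\mathbf z})=\sum_{j=1}^{n} z_j^{a_j+b_j}\,\bar z_j^{\,b_j}\,z_{j+1},\qquad g_{II}(\mathbf z)=\sum_{j=1}^{n} z_j^{a_j}z_{j+1},$$ $$f_{II,t}=(1-t)f_{II}+t\,g_{II},\qquad V_t=f_{II,t}^{-1}(0)\subset\mathbb C^n,\qquad 0\le t\le 1 .$$ Assume that $b_j\ge 1$ for some $j$, that $a_k\ge 2$ for some $k$, and that $g_{II}$ is weighted homogeneous with positive weights, i.e. there are positive integers $p_1,\dots,p_n,d$ with $a_jp_j+p_{j+1}=d$ for all $j$ (where $p_{n+1}=p_1$). (Given the other assumptions, the last one fails only if $n$ is even and $a_j=1$ for all even $j$, or $a_j=1$ for all odd $j$.) Then for every $r>0$ and every $t\in[0,1]$ the sphere $S^{2n-1}_r=\{\|\mathbf z\|=r\}$ and $V_t$ are transversal. That is, at every $\mathbf w\in S^{2n-1}_r\cap V_t$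 the real differential of $f_{II,t}:\mathbb C^n\to\mathbb C$ is surjective (so $V_t$ is a smooth real submanifold of codimension $2$ near $\mathbf w$, with tangent space $T_{\mathbf w}V_t=\ker d(f_{II,t})_{\mathbf w}$), and $T_{\mathbf w}V_t+T_{\mathbf w}S^{2n-1}_r=\mathbb C^n$. -/

import Mathlib

open scoped ComplexConjugate

noncomputable section

/-- The mixed polynomial of cyclic type
`f_II(z, z̄) = ∑ j, z_j ^ (a_j + b_j) * z̄_j ^ b_j * z_{j+1}` on `ℂⁿ` with its Euclidean norm.
Addition in `Fin n` is modulo `n`, so the successor of the last index is the first one. -/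
def fII {n : ℕ} [NeZero n] (a b : Fin n → ℕ) (z : EuclideanSpace ℂ (Fin n)) : ℂ :=
  ∑ j : Fin n, z j ^ (a j + b j) * conj (z j) ^ b j * z (j + 1)

/-- The associated polynomial `g_II(z) = ∑ j, z_j ^ a_j * z_{j+1}`. -/
def gII {n : ℕ} [NeZero n] (a : Fin n → ℕ) (z : EuclideanSpace ℂ (Fin n)) : ℂ :=
  ∑ j : Fin n, z j ^ a j * z (j + 1)

/-- The family `f_{II,t} = (1 - t) f_II + t g_II`. -/
def fIIt {n : ℕ} [NeZero n] (a b : Fin n → ℕ) (t : ℝ) (z : EuclideanSpace ℂ (Fin n)) : ℂ :=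
  (1 - (t : ℂ)) * fII a b z + (t : ℂ) * gII a z

/-- The hypersurface `V_t = f_{II,t}⁻¹(0)`. -/
def Vt {n : ℕ} [NeZero n] (a b : Fin n → ℕ) (t : ℝ) : Set (EuclideanSpace ℂ (Fin n)) :=
  {z | fIIt a b t z = 0}

/-- `g_II` is weighted homogeneous in the usual sense, with positive integer weights `p_j`:
every monomial `z_j ^ a_j * z_{j+1}` has the same weighted degree `d`. -/
def HasPositiveWeights {n : ℕ} [NeZero n] (a : Fin n → ℕ) : Prop :=
  ∃ (p : Fin n → ℕ) (d : ℕ), (∀ j, 0 < p j) ∧ ∀ j, a j * p j + p (j + 1) = d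

/-- The level sets of `F` and `H` through `w` are transversal at `w`: both maps are submersive
at `w`, so that their level sets through `w` are submanifolds near `w` with tangent spaces
`ker dF_w` and `ker dH_w`, and these tangent spaces together span the ambient space. -/
structure LevelSetsTransversalAt {E G K : Type*} [NormedAddCommGroup E] [NormedSpace ℝ E]
    [NormedAddCommGroup G] [NormedSpace ℝ G] [NormedAddCommGroup K] [NormedSpace ℝ K]
    (F : E → G) (H : E → K) (w : E) : Prop where
  differentiableAt_left : DifferentiableAt ℝ F w
  differentiableAt_right : DifferentiableAt ℝ H w
  regular_left : Function.Surjective (fderiv ℝ F w)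
  regular_right : Function.Surjective (fderiv ℝ H w)
  tangent_sup : LinearMap.ker (fderiv ℝ F w).toLinearMap ⊔
    LinearMap.ker (fderiv ℝ H w).toLinearMap = ⊤

/-- The sphere of radius `r` about the origin, a level set of `z ↦ ‖z‖ ^ 2`, and `V_t` are
transversal, i.e. transversal at each of their common points. -/
def SphereTransversal {n : ℕ} [NeZero n] (a b : Fin n → ℕ) (t r : ℝ) : Prop :=
  ∀ w ∈ Metric.sphere (0 : EuclideanSpace ℂ (Fin n)) r ∩ Vt a b t,
    LevelSetsTransversalAt (fIIt a b t)
      (fun z : EuclideanSpace ℂ (Fin n) => ‖z‖ ^ 2) w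

end

/-!
Write `f_{II,t} = ∑ φ_j(z_j) z_{j+1}`. At a point `w` the radial derivative of `φ_j` is a real
multiple `c_j ≥ a_j` of `φ_j(w_j)`. The system `c_j q_j + q_{j+1} = 1` has a positive solution `q`,
and for `v = (q_j w_j)_j` one gets `df(v) = f(w)`, as in Euler's identity, and
`d‖z‖²(v) = 2 ∑ q_j |w_j|² > 0`. On `V_t` the vector `v` is therefore tangent to `V_t` but not to
the sphere, and only the surjectivity of `df` at `w ≠ 0` remains.

If `Re(λ df) = 0` with `λ ≠ 0`, testing on `w_j e_j` and on `i w_j e_j` gives for the real and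
imaginary parts of `λ φ_j(w_j) w_{j+1}` two homogeneous cyclic systems with only the trivial
solution, so no two neighbouring coordinates of `w` are nonzero. Testing on `e_{j+1}` where
`w_j ≠ 0` then forces `a_{j+1} = 1` and `w_{j+2} ≠ 0`. Continuing around the cycle makes every
second exponent equal to `1`, and positive weights would then force all exponents to be `1`.

Only the permutation `j ↦ j + 1` enters; every second index then means an orbit of `σ²`.
-/

open Equiv (Perm)

open scoped InnerProductSpace

section Orbits

variable {ι : Type*} {σ : Perm ι} {i j : ι}

theorem sameCycle_sq_or_of_sameCycle (hij : σ.SameCycle i j) :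
    (σ ^ 2).SameCycle i j ∨ (σ ^ 2).SameCycle i (σ.symm j) := by
  obtain ⟨m, rfl⟩ := hij
  rcases Int.even_or_odd' m with ⟨l, rfl | rfl⟩
  · exact .inl ⟨l, by rw [← zpow_natCast, ← zpow_mul]; rfl⟩
  · refine .inr ⟨l, σ.injective ?_⟩
    rw [Equiv.apply_symm_apply, ← Equiv.Perm.mul_apply, ← zpow_natCast, ← zpow_mul,
      ← zpow_one_add, add_comm]
    rfl

variable [Finite ι]

theorem sameCycle_induction {P : ι → Prop} (hij : σ.SameCycle i j) (base : P i)
    (step : ∀ k, P k → P (σ k)) : P j := by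
  obtain ⟨m, rfl⟩ := hij.exists_nat_pow_eq
  induction m with
  | zero => exact base
  | succ m ih =>
    rw [pow_succ', Equiv.Perm.mul_apply]
    exact step _ (ih ⟨m, rfl⟩)

theorem le_of_sameCycle {α : Type*} [Preorder α] {y : ι → α} (hij : σ.SameCycle i j)
    (hy : ∀ k, σ.SameCycle i k → y k ≤ y (σ k)) : y i ≤ y j :=
  (sameCycle_induction (P := fun k => σ.SameCycle i k ∧ y i ≤ y k) hij ⟨.refl σ i, le_rfl⟩
    fun k ⟨hik, hle⟩ => ⟨hik.apply_right, hle.trans (hy k hik)⟩).2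

theorem eq_of_sameCycle {α : Type*} [PartialOrder α] {y : ι → α} (hij : σ.SameCycle i j)
    (hy : ∀ k, σ.SameCycle i k → y k ≤ y (σ k)) : y i = y j :=
  (le_of_sameCycle hij hy).antisymm
    (le_of_sameCycle hij.symm fun k hjk => hy k (hij.trans hjk))

end Orbits

section Weights

variable {ι : Type*} {σ : Perm ι} {c : ι → ℝ}

/-- The equation at `σ l` gives `q (σ l) ≤ 1 - q l`, the one at `l` gives the reverse inequality;
equality then leaves no slack in the equation at `σ l`. -/
theorem eq_one_and_apply_apply_eq_of_min_nonpos {q : ι → ℝ} (hc : ∀ j, 1 ≤ c j)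
    (hq : ∀ j, c j * q j + q (σ j) = 1) {l : ι} (hmin : ∀ j, q l ≤ q j) (hl : q l ≤ 0) :
    c (σ l) = 1 ∧ q (σ (σ l)) = q l := by
  have hmax : q (σ l) ≤ 1 - q l := by
    nlinarith [hc (σ l), hq (σ l), hmin (σ (σ l))]
  have hnext : q (σ l) = 1 - q l := hmax.antisymm (by nlinarith [hc l, hq l])
  have hq' := hq (σ l)
  rw [hnext] at hq'
  have hone : c (σ l) = 1 := (hc _).antisymm' (by nlinarith [hmin (σ (σ l))])
  rw [hone] at hq'
  exact ⟨hone, by linarith⟩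

variable [Finite ι]

theorem eq_zero_of_mul_add_apply_eq_zero {u : ι → ℝ} (hc : ∀ j, 1 ≤ c j)
    (hσ : ∀ j, ∃ k, σ.SameCycle j k ∧ 1 < c k) (hu : ∀ j, c j * u j + u (σ j) = 0) (j : ι) :
    u j = 0 := by
  have habs (i : ι) : |u (σ i)| = c i * |u i| := by
    rw [eq_neg_of_add_eq_zero_right (hu i), abs_neg, abs_mul, abs_of_pos (one_pos.trans_le (hc i))]
  have hmono (i : ι) : |u i| ≤ |u (σ i)| :=
    (le_mul_of_one_le_left (abs_nonneg _) (hc i)).trans_eq (habs i).symm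
  obtain ⟨k, hjk, hk⟩ := hσ j
  have hconst {i i' : ι} (h : σ.SameCycle i i') : |u i| = |u i'| :=
    eq_of_sameCycle (y := fun i => |u i|) h fun i _ => hmono i
  have hzero : u k = 0 := by
    have hfixed : |u k| = c k * |u k| := (hconst (.apply_right (.refl σ k))).trans (habs k)
    exact abs_eq_zero.1 (by nlinarith [abs_nonneg (u k)])
  rw [← abs_eq_zero, hconst hjk, hzero, abs_zero]

theorem pos_of_mul_add_apply_eq_one {q : ι → ℝ} (hc : ∀ j, 1 ≤ c j)
    (hσ : ∀ j, ∃ k, (σ ^ 2).SameCycle j k ∧ 1 < c k) (hq : ∀ j, c j * q j + q (σ j) = 1)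
    (j : ι) : 0 < q j := by
  have : Nonempty ι := ⟨j⟩
  obtain ⟨l, hmin⟩ := Finite.exists_min q
  refine lt_of_lt_of_le ?_ (hmin j)
  by_contra! hl
  have hpropagate (i : ι) (hi : q (σ.symm i) = q l) : c i = 1 ∧ q (σ i) = q l := by
    simpa [hi] using eq_one_and_apply_apply_eq_of_min_nonpos hc hq (l := σ.symm i)
      (by simpa [hi] using hmin) (hi ▸ hl)
  obtain ⟨k, hlk, hk⟩ := hσ (σ l)
  have hqk : q (σ.symm k) = q l :=
    sameCycle_induction (P := fun i => q (σ.symm i) = q l) hlk (by simp) fun i hi => by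
      simpa [sq] using (hpropagate i hi).2
  exact hk.ne' (hpropagate k hqk).1

theorem exists_pos_mul_add_apply_eq_one (hc : ∀ j, 1 ≤ c j)
    (hσ : ∀ j, ∃ k, (σ ^ 2).SameCycle j k ∧ 1 < c k) :
    ∃ q : ι → ℝ, (∀ j, 0 < q j) ∧ ∀ j, c j * q j + q (σ j) = 1 := by
  let T : (ι → ℝ) →ₗ[ℝ] (ι → ℝ) := .pi fun j => c j • .proj j + .proj (σ j)
  have hT : Function.Injective T := by
    rw [injective_iff_map_eq_zero]
    intro u hu
    funext j
    exact eq_zero_of_mul_add_apply_eq_zero hc (fun j => (hσ j).imp fun k hk => ⟨hk.1.of_pow, hk.2⟩)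
      (congrFun hu) j
  obtain ⟨q, hq⟩ := LinearMap.injective_iff_surjective.1 hT 1
  exact ⟨q, pos_of_mul_add_apply_eq_one hc hσ (congrFun hq), congrFun hq⟩

/-- On a `σ²`-orbit where `a` is constantly `1` the weights `p` would be nonincreasing, hence
constant, which forces `a` to be `1` on the image of the orbit under `σ` as well. -/
theorem exists_sameCycle_sq_two_le_of_weights {a p : ι → ℕ} {d : ℕ} (hp : ∀ j, 0 < p j)
    (hd : ∀ j, a j * p j + p (σ j) = d) (ha : ∀ j, 1 ≤ a j)
    (hσ : ∀ j, ∃ k, σ.SameCycle j k ∧ 2 ≤ a k) (j : ι) :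
    ∃ k, (σ ^ 2).SameCycle j k ∧ 2 ≤ a k := by
  by_contra! hlt
  have hone (k : ι) (hjk : (σ ^ 2).SameCycle j k) : a k = 1 :=
    (Nat.le_of_lt_succ (hlt k hjk)).antisymm (ha k)
  have hsum (k : ι) (hjk : (σ ^ 2).SameCycle j k) : p k + p (σ k) = d := by
    simpa [hone k hjk] using hd k
  have hanti (k : ι) (hjk : (σ ^ 2).SameCycle j k) : p ((σ ^ 2) k) ≤ p k := by
    have : p (σ k) ≤ a (σ k) * p (σ k) := Nat.le_mul_of_pos_left _ (ha _)
    have := hd (σ k)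
    have := hsum k hjk
    rw [sq, Equiv.Perm.mul_apply]
    omega
  have hconst (k : ι) (hjk : (σ ^ 2).SameCycle j k) : p k = p ((σ ^ 2) k) :=
    eq_of_sameCycle (α := ℕᵒᵈ) (y := p) (.apply_right (.refl _ k)) fun i hki =>
      hanti i (hjk.trans hki)
  have hone_apply (k : ι) (hjk : (σ ^ 2).SameCycle j k) : a (σ k) = 1 := by
    refine Nat.eq_of_mul_eq_mul_right (hp (σ k)) ?_
    have := hd (σ k)
    have := hsum k hjk
    have := hconst k hjk
    rw [sq, Equiv.Perm.mul_apply] at this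
    omega
  obtain ⟨k, hjk, hk⟩ := hσ j
  have : a k = 1 := (sameCycle_sq_or_of_sameCycle hjk).elim (hone k) fun h => by
    simpa using hone_apply _ h
  omega

end Weights

section RadialMonomial

/-- A weight `ρ` that is differentiable and, on `(0, ∞)`, positive and nondecreasing. It is meant to
be evaluated at the squared modulus of a complex variable. -/
structure IsRadialWeight (ρ : ℝ → ℝ) : Prop where
  differentiable : Differentiable ℝ ρ
  pos : ∀ s, 0 < s → 0 < ρ s
  deriv_nonneg : ∀ s, 0 < s → 0 ≤ deriv ρ s

theorem IsRadialWeight.interpolation (l : ℕ) {t : ℝ} (ht : t ∈ Set.Icc (0 : ℝ) 1) :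
    IsRadialWeight fun s => (1 - t) * s ^ l + t where
  differentiable := by fun_prop
  pos s hs := by
    rcases ht.1.eq_or_lt with rfl | h
    · simpa using pow_pos hs l
    · have := mul_nonneg (sub_nonneg.2 ht.2) (pow_pos hs l).le
      positivity
  deriv_nonneg s hs := by
    have hderiv : deriv (fun s => (1 - t) * s ^ l + t) s = (1 - t) * (l * s ^ (l - 1)) := by simp
    have := sub_nonneg.2 ht.2
    rw [hderiv]
    positivity

/-- The monomial `ζ ^ m` with the coefficient `ρ (|ζ|²)`. For `ρ s = s ^ l` this is the mixed
monomial `ζ ^ (m + l) * conj ζ ^ l`. -/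
noncomputable def radialMonomial (ρ : ℝ → ℝ) (m : ℕ) (ζ : ℂ) : ℂ :=
  ρ (‖ζ‖ ^ 2) • ζ ^ m

/-- The logarithmic derivative of `radialMonomial ρ m` in the radial direction at `ζ`, by which it
behaves at `ζ` like a function homogeneous of this degree. -/
noncomputable def radialDegree (ρ : ℝ → ℝ) (m : ℕ) (ζ : ℂ) : ℝ :=
  m + 2 * ‖ζ‖ ^ 2 * deriv ρ (‖ζ‖ ^ 2) / ρ (‖ζ‖ ^ 2)

variable {ρ : ℝ → ℝ} {m : ℕ} {ζ : ℂ}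

theorem radialMonomial_ne_zero (hρ : IsRadialWeight ρ) (hζ : ζ ≠ 0) : radialMonomial ρ m ζ ≠ 0 :=
  smul_ne_zero (hρ.pos _ (by positivity)).ne' (pow_ne_zero m hζ)

theorem le_radialDegree (hρ : IsRadialWeight ρ) : m ≤ radialDegree ρ m ζ := by
  rcases eq_or_ne ζ 0 with rfl | hζ
  · simp [radialDegree]
  · have hs : 0 < ‖ζ‖ ^ 2 := by positivity
    have := hρ.pos _ hs
    have := hρ.deriv_nonneg _ hs
    exact le_add_of_nonneg_right (by positivity)

theorem hasFDerivAt_radialMonomial (hρ : Differentiable ℝ ρ) :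
    HasFDerivAt (radialMonomial ρ m)
      (ρ (‖ζ‖ ^ 2) • (m * ζ ^ (m - 1)) • ContinuousLinearMap.id ℝ ℂ +
        (deriv ρ (‖ζ‖ ^ 2) • 2 • innerSL ℝ ζ).smulRight (ζ ^ m)) ζ := by
  have hweight : HasFDerivAt (fun z : ℂ => ρ (‖z‖ ^ 2)) _ ζ :=
    (hρ (‖ζ‖ ^ 2)).hasDerivAt.comp_hasFDerivAt ζ (hasStrictFDerivAt_norm_sq ζ).hasFDerivAt
  have hpow : HasFDerivAt (𝕜 := ℝ) (fun z : ℂ => z ^ m) _ ζ := (hasFDerivAt_id ζ).pow m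
  refine (hweight.smul hpow).congr_fderiv ?_
  ext v
  simp

theorem fderiv_radialMonomial_apply (hρ : Differentiable ℝ ρ) (v : ℂ) :
    fderiv ℝ (radialMonomial ρ m) ζ v =
      ρ (‖ζ‖ ^ 2) * (m * ζ ^ (m - 1) * v) + deriv ρ (‖ζ‖ ^ 2) * (2 * ⟪ζ, v⟫_ℝ) * ζ ^ m := by
  rw [(hasFDerivAt_radialMonomial hρ).fderiv]
  simp [mul_add]

theorem fderiv_radialMonomial_self (hρ : IsRadialWeight ρ) (hm : m ≠ 0) :
    fderiv ℝ (radialMonomial ρ m) ζ ζ = radialDegree ρ m ζ * radialMonomial ρ m ζ := by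
  rw [fderiv_radialMonomial_apply hρ.differentiable]
  rcases eq_or_ne ζ 0 with rfl | hζ
  · simp [radialMonomial, hm]
  have hne : (ρ (‖ζ‖ ^ 2) : ℂ) ≠ 0 := by
    exact Complex.ofReal_ne_zero.2 (hρ.pos _ (by positivity)).ne'
  rw [mul_assoc, pow_sub_one_mul hm, real_inner_self_eq_norm_sq, radialMonomial, radialDegree]
  push_cast
  rw [Complex.real_smul]
  field_simp

theorem fderiv_radialMonomial_I_mul (hρ : Differentiable ℝ ρ) :
    fderiv ℝ (radialMonomial ρ m) ζ (Complex.I * ζ) = m * Complex.I * radialMonomial ρ m ζ := by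
  have horth : ⟪ζ, Complex.I * ζ⟫_ℝ = 0 := by
    rw [Complex.inner, mul_assoc, Complex.mul_conj, Complex.I_mul_re, Complex.ofReal_im, neg_zero]
  rw [fderiv_radialMonomial_apply hρ, horth, radialMonomial, Complex.real_smul]
  rcases eq_or_ne m 0 with rfl | hm
  · simp
  · simp only [Complex.ofReal_zero, mul_zero, zero_mul, add_zero]
    linear_combination ρ (‖ζ‖ ^ 2) * m * Complex.I * pow_sub_one_mul hm ζ

theorem fderiv_radialMonomial_zero (hρ : Differentiable ℝ ρ) (v : ℂ) :
    fderiv ℝ (radialMonomial ρ m) 0 v = ρ 0 * (m * 0 ^ (m - 1)) * v := by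
  rw [fderiv_radialMonomial_apply hρ]
  simp [mul_assoc]

end RadialMonomial

section Transversality

variable {E G : Type*} [NormedAddCommGroup E] [NormedSpace ℝ E] [NormedAddCommGroup G]
  [NormedSpace ℝ G]

theorem LevelSetsTransversalAt.of_fderiv_apply_ne_zero {F : E → G} {H : E → ℝ} {w v : E}
    (hF : DifferentiableAt ℝ F w) (hH : DifferentiableAt ℝ H w)
    (hsurj : Function.Surjective (fderiv ℝ F w)) (hFv : fderiv ℝ F w v = 0)
    (hHv : fderiv ℝ H w v ≠ 0) : LevelSetsTransversalAt F H w where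
  differentiableAt_left := hF
  differentiableAt_right := hH
  regular_left := hsurj
  regular_right := LinearMap.surjective (f := (fderiv ℝ H w).toLinearMap) fun h =>
    hHv (LinearMap.congr_fun h v)
  tangent_sup := by
    refine eq_top_iff.2 fun x _ => Submodule.mem_sup.2
      ⟨(fderiv ℝ H w x / fderiv ℝ H w v) • v, ?_, x - (fderiv ℝ H w x / fderiv ℝ H w v) • v, ?_,
        add_sub_cancel _ _⟩
    · simp [hFv]
    · simp [hHv]

theorem exists_re_mul_eq_zero_of_not_surjective {V : Type*} [AddCommGroup V] [Module ℝ V]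
    (T : V →ₗ[ℝ] ℂ) (hT : ¬ Function.Surjective T) :
    ∃ lam : ℂ, lam ≠ 0 ∧ ∀ v, (lam * T v).re = 0 := by
  have hrange : T.rangeᗮ ≠ ⊥ := by
    rwa [Ne, Submodule.orthogonal_eq_bot_iff, LinearMap.range_eq_top]
  obtain ⟨x, hx, hx0⟩ := Submodule.exists_mem_ne_zero_of_ne_bot hrange
  refine ⟨conj x, by simpa using hx0, fun v => ?_⟩
  have h := Submodule.inner_left_of_mem_orthogonal (LinearMap.mem_range_self T v) hx
  rwa [Complex.inner, mul_comm] at h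

theorem inner_smul_coord_pos {ι : Type*} [Fintype ι] {q : ι → ℝ} (hq : ∀ j, 0 < q j)
    {w : EuclideanSpace ℂ ι} (hw : w ≠ 0) : 0 < ⟪w, WithLp.toLp 2 fun j => q j • w j⟫_ℝ := by
  obtain ⟨k, hk⟩ := Function.ne_iff.1 ((WithLp.ofLp_eq_zero 2).not.2 hw)
  simp only [PiLp.inner_apply, real_inner_smul_right, real_inner_self_eq_norm_sq]
  have hterm (j : ι) : 0 ≤ q j * ‖w j‖ ^ 2 := mul_nonneg (hq j).le (sq_nonneg _)
  exact Finset.sum_pos' (fun j _ => hterm j)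
    ⟨k, Finset.mem_univ k, mul_pos (hq k) (by positivity)⟩

end Transversality

section PermSum

variable {ι : Type*} [Fintype ι] {σ : Perm ι} {a : ι → ℕ} {ρ : ι → ℝ → ℝ}
  {w : EuclideanSpace ℂ ι}

/-- The radially weighted polynomial `∑ j, ρ_j (|z_j|²) z_j ^ a_j * z_{σ j}` attached to a
permutation `σ`. The family `f_{II,t}` is the case of the cyclic shift and of
`ρ_j s = (1 - t) s ^ b_j + t`. -/
noncomputable def radialPermSum (σ : Perm ι) (a : ι → ℕ) (ρ : ι → ℝ → ℝ)
    (z : EuclideanSpace ℂ ι) : ℂ :=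
  ∑ j, radialMonomial (ρ j) (a j) (z j) * z (σ j)

theorem hasFDerivAt_radialPermSum (hρ : ∀ j, Differentiable ℝ (ρ j)) :
    HasFDerivAt (radialPermSum σ a ρ)
      (∑ j, (radialMonomial (ρ j) (a j) (w j) •
          (EuclideanSpace.proj (σ j) : EuclideanSpace ℂ ι →L[ℂ] ℂ).restrictScalars ℝ +
        w (σ j) • (fderiv ℝ (radialMonomial (ρ j) (a j)) (w j)).comp
          ((EuclideanSpace.proj j : EuclideanSpace ℂ ι →L[ℂ] ℂ).restrictScalars ℝ))) w := by
  have hproj (j : ι) : HasFDerivAt (𝕜 := ℝ) (fun z : EuclideanSpace ℂ ι => z j) _ w :=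
    ((EuclideanSpace.proj j : EuclideanSpace ℂ ι →L[ℂ] ℂ).restrictScalars ℝ).hasFDerivAt
  have hmonomial (j : ι) :=
    (hasFDerivAt_radialMonomial (m := a j) (ζ := w j) (hρ j)).differentiableAt.hasFDerivAt
  exact .fun_sum fun j _ => ((hmonomial j).comp w (hproj j)).mul (hproj (σ j))

theorem fderiv_radialPermSum_apply (hρ : ∀ j, Differentiable ℝ (ρ j)) (v : EuclideanSpace ℂ ι) :
    fderiv ℝ (radialPermSum σ a ρ) w v =
      ∑ j, (fderiv ℝ (radialMonomial (ρ j) (a j)) (w j) (v j) * w (σ j) +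
        radialMonomial (ρ j) (a j) (w j) * v (σ j)) := by
  rw [(hasFDerivAt_radialPermSum hρ).fderiv]
  simp [add_comm, mul_comm]

theorem fderiv_radialPermSum_single [DecidableEq ι] (hρ : ∀ j, Differentiable ℝ (ρ j)) (j : ι)
    (ξ : ℂ) :
    fderiv ℝ (radialPermSum σ a ρ) w (EuclideanSpace.single j ξ) =
      fderiv ℝ (radialMonomial (ρ j) (a j)) (w j) ξ * w (σ j) +
        radialMonomial (ρ (σ.symm j)) (a (σ.symm j)) (w (σ.symm j)) * ξ := by
  rw [fderiv_radialPermSum_apply hρ, Finset.sum_add_distrib,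
    Finset.sum_eq_single j (fun i _ hi => by simp [hi]) (by simp),
    Finset.sum_eq_single (σ.symm j) (fun i _ hi => by simp [← Equiv.eq_symm_apply, hi]) (by simp)]
  simp

/-- Euler's identity at the single point `w`, with real weights adapted to that point. -/
theorem fderiv_radialPermSum_weighted (hρ : ∀ j, IsRadialWeight (ρ j)) (ha : ∀ j, a j ≠ 0)
    {q : ι → ℝ} (hq : ∀ j, radialDegree (ρ j) (a j) (w j) * q j + q (σ j) = 1) :
    fderiv ℝ (radialPermSum σ a ρ) w (WithLp.toLp 2 fun j => q j • w j) =
      radialPermSum σ a ρ w := by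
  rw [fderiv_radialPermSum_apply fun j => (hρ j).differentiable]
  refine Finset.sum_congr rfl fun j _ => ?_
  have hqj : (radialDegree (ρ j) (a j) (w j) * q j + q (σ j) : ℂ) = 1 := by exact_mod_cast hq j
  simp only [map_smul, fderiv_radialMonomial_self (hρ j) (ha j)]
  simp only [Complex.real_smul]
  linear_combination radialMonomial (ρ j) (a j) (w j) * w (σ j) * hqj

theorem mul_monomial_eq_zero_of_re_mul_fderiv_eq_zero (hρ : ∀ j, IsRadialWeight (ρ j))
    (ha : ∀ j, 1 ≤ a j) (hσ : ∀ j, ∃ k, σ.SameCycle j k ∧ 2 ≤ a k) {lam : ℂ}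
    (hlam : ∀ v, (lam * fderiv ℝ (radialPermSum σ a ρ) w v).re = 0) (j : ι) :
    lam * (radialMonomial (ρ j) (a j) (w j) * w (σ j)) = 0 := by
  classical
  set N : ι → ℂ := fun j => lam * (radialMonomial (ρ j) (a j) (w j) * w (σ j)) with hN
  have hsingle (i : ι) (ξ : ℂ) := fderiv_radialPermSum_single (σ := σ) (a := a) (w := w)
    (fun j => (hρ j).differentiable) i ξ
  have hdegree (i : ι) : (a i : ℝ) ≤ radialDegree (ρ i) (a i) (w i) := le_radialDegree (hρ i)
  have hre (i : ι) :
      radialDegree (ρ i) (a i) (w i) * (N i).re + (N (σ⁻¹ i)).re = 0 := by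
    have h := hlam (.single i (w i))
    rw [hsingle, fderiv_radialMonomial_self (hρ i) (Nat.one_le_iff_ne_zero.1 (ha i))] at h
    rw [← h, ← Complex.re_ofReal_mul, ← Complex.add_re]
    congr 1
    simp only [hN, Perm.coe_inv, Equiv.apply_symm_apply]
    ring
  have him (i : ι) : (a i : ℝ) * (N i).im + (N (σ⁻¹ i)).im = 0 := by
    have h := hlam (.single i (Complex.I * w i))
    rw [hsingle, fderiv_radialMonomial_I_mul (hρ i).differentiable] at h
    rw [← neg_eq_zero, ← h, ← Complex.im_ofReal_mul, ← Complex.add_im, ← Complex.I_mul_re]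
    congr 1
    simp only [Complex.ofReal_natCast, hN, Perm.coe_inv, Equiv.apply_symm_apply]
    ring
  have ha' (i : ι) : (1 : ℝ) ≤ a i := by exact_mod_cast ha i
  have hσ' (i : ι) : ∃ k, σ⁻¹.SameCycle i k ∧ (1 : ℝ) < a k :=
    (hσ i).imp fun k hk => ⟨hk.1.inv, by exact_mod_cast hk.2⟩
  exact Complex.ext
    (eq_zero_of_mul_add_apply_eq_zero (fun i => (ha' i).trans (hdegree i))
      (fun i => (hσ' i).imp fun k hk => ⟨hk.1, hk.2.trans_le (hdegree k)⟩) hre j)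
    (eq_zero_of_mul_add_apply_eq_zero ha' hσ' him j)

theorem eq_one_and_apply_ne_zero_of_re_mul_fderiv_eq_zero (hρ : ∀ j, IsRadialWeight (ρ j))
    (ha : ∀ j, 1 ≤ a j) {lam : ℂ} (hlam0 : lam ≠ 0)
    (hlam : ∀ v, (lam * fderiv ℝ (radialPermSum σ a ρ) w v).re = 0) {j : ι} (hj : w j = 0)
    (hj' : w (σ.symm j) ≠ 0) : a j = 1 ∧ w (σ j) ≠ 0 := by
  classical
  set x := ρ j 0 * (a j * 0 ^ (a j - 1)) * w (σ j) +
    radialMonomial (ρ (σ.symm j)) (a (σ.symm j)) (w (σ.symm j)) with hx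
  have hsingle (ξ : ℂ) : fderiv ℝ (radialPermSum σ a ρ) w (.single j ξ) = x * ξ := by
    rw [fderiv_radialPermSum_single fun j => (hρ j).differentiable, hj,
      fderiv_radialMonomial_zero (hρ j).differentiable]
    ring
  have hx0 : x = 0 := by
    have h := hlam (.single j (conj (lam * x)))
    rw [hsingle, ← mul_assoc, Complex.mul_conj, Complex.ofReal_re, Complex.normSq_eq_zero] at h
    exact (mul_eq_zero.1 h).resolve_left hlam0
  have hne := radialMonomial_ne_zero (m := a (σ.symm j)) (hρ (σ.symm j)) hj'
  refine ⟨(ha j).antisymm' ?_, fun h => hne (by simpa [hx, h] using hx0)⟩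
  by_contra! h
  exact hne (by simpa [hx, Nat.sub_ne_zero_of_lt h] using hx0)

theorem surjective_fderiv_radialPermSum (hρ : ∀ j, IsRadialWeight (ρ j)) (ha : ∀ j, 1 ≤ a j)
    (hσ : ∀ j, ∃ k, (σ ^ 2).SameCycle j k ∧ 2 ≤ a k) (hw : w ≠ 0) :
    Function.Surjective (fderiv ℝ (radialPermSum σ a ρ) w) := by
  by_contra hsurj
  obtain ⟨lam, hlam0, hlam⟩ :=
    exists_re_mul_eq_zero_of_not_surjective (fderiv ℝ (radialPermSum σ a ρ) w).toLinearMap hsurj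
  have hadjacent (j : ι) (hj : w j ≠ 0) : w (σ j) = 0 := by
    have h := mul_monomial_eq_zero_of_re_mul_fderiv_eq_zero hρ ha
      (fun j => (hσ j).imp fun k hk => ⟨hk.1.of_pow, hk.2⟩) hlam j
    simpa [hlam0, radialMonomial_ne_zero (hρ j) hj] using h
  have hpropagate (j : ι) (hj : w (σ.symm j) ≠ 0) : a j = 1 ∧ w (σ j) ≠ 0 :=
    eq_one_and_apply_ne_zero_of_re_mul_fderiv_eq_zero hρ ha hlam0 hlam
      (by simpa using hadjacent _ hj) hj
  obtain ⟨l, hl⟩ := Function.ne_iff.1 ((WithLp.ofLp_eq_zero 2).not.2 hw)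
  obtain ⟨k, hlk, hk⟩ := hσ (σ l)
  have hwk : w (σ.symm k) ≠ 0 :=
    sameCycle_induction (P := fun j => w (σ.symm j) ≠ 0) hlk (by simpa using hl) fun j hj => by
      simpa [sq] using (hpropagate j hj).2
  have := (hpropagate k hwk).1
  omega

end PermSum

theorem mainTheorem1_general {ι : Type*} [Fintype ι] (σ : Perm ι) (a : ι → ℕ) (ρ : ι → ℝ → ℝ)
    (hρ : ∀ j, IsRadialWeight (ρ j)) (ha : ∀ j, 1 ≤ a j)
    (hσ : ∀ j, ∃ k, (σ ^ 2).SameCycle j k ∧ 2 ≤ a k) (w : EuclideanSpace ℂ ι) (hw : w ≠ 0)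
    (hV : radialPermSum σ a ρ w = 0) :
    LevelSetsTransversalAt (radialPermSum σ a ρ) (fun z => ‖z‖ ^ 2) w := by
  have hdegree (j : ι) : (a j : ℝ) ≤ radialDegree (ρ j) (a j) (w j) := le_radialDegree (hρ j)
  obtain ⟨q, hq0, hq⟩ := exists_pos_mul_add_apply_eq_one (σ := σ)
    (fun j => (Nat.one_le_cast.2 (ha j)).trans (hdegree j)) fun j =>
      (hσ j).imp fun k hk => ⟨hk.1, (Nat.one_lt_cast.2 hk.2).trans_le (hdegree k)⟩
  refine .of_fderiv_apply_ne_zero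
    (hasFDerivAt_radialPermSum fun j => (hρ j).differentiable).differentiableAt
    (hasStrictFDerivAt_norm_sq w).differentiableAt (surjective_fderiv_radialPermSum hρ ha hσ hw)
    ((fderiv_radialPermSum_weighted hρ (fun j => Nat.one_le_iff_ne_zero.1 (ha j)) hq).trans hV) ?_
  rw [fderiv_norm_sq_apply]
  simpa using (inner_smul_coord_pos hq0 hw).ne'

section Cyclic

variable {n : ℕ} [NeZero n]

open Fin.CommRing in
theorem sameCycle_addRight_one (j k : Fin n) : (Equiv.addRight 1 : Perm (Fin n)).SameCycle j k :=
  ⟨(k - j).val, by simp [-zsmul_eq_mul, -nsmul_eq_mul, nsmul_one]⟩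

theorem HasPositiveWeights.exists_sameCycle_sq_two_le {a : Fin n → ℕ} (h : HasPositiveWeights a)
    (ha : ∀ j, 1 ≤ a j) (ha2 : ∃ k, 2 ≤ a k) (j : Fin n) :
    ∃ k, (Equiv.addRight (1 : Fin n) ^ 2).SameCycle j k ∧ 2 ≤ a k := by
  obtain ⟨p, d, hp, hd⟩ := h
  exact exists_sameCycle_sq_two_le_of_weights hp hd ha
    (fun i => ha2.imp fun k hk => ⟨sameCycle_addRight_one i k, hk⟩) j

theorem fIIt_eq_radialPermSum (a b : Fin n → ℕ) (t : ℝ) :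
    fIIt a b t = radialPermSum (Equiv.addRight 1) a fun j s => (1 - t) * s ^ b j + t := by
  funext z
  simp only [fIIt, fII, gII, radialPermSum, Finset.mul_sum, ← Finset.sum_add_distrib]
  refine Finset.sum_congr rfl fun j _ => ?_
  simp only [radialMonomial, Complex.real_smul, Equiv.coe_addRight]
  push_cast
  rw [← Complex.mul_conj']
  ring

end Cyclic

theorem mainTheorem1 {n : ℕ} [NeZero n] (a b : Fin n → ℕ)
    (ha : ∀ j, 1 ≤ a j) (hb : ∃ j, 1 ≤ b j) (ha2 : ∃ k, 2 ≤ a k)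
    (hw : HasPositiveWeights a)
    (r : ℝ) (hr : 0 < r) (t : ℝ) (ht : t ∈ Set.Icc (0 : ℝ) 1) :
    SphereTransversal a b t r :=
  fun w ⟨hwr, hwV⟩ => fIIt_eq_radialPermSum a b t ▸ mainTheorem1_general _ a _
    (fun j => .interpolation (b j) ht) ha (hw.exists_sameCycle_sq_two_le ha ha2) w
    (ne_zero_of_mem_sphere hr.ne' ⟨w, hwr⟩)
    ((congrFun (fIIt_eq_radialPermSum a b t) w).symm.trans hwV)
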